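/- Let $\mathbb{HP}^1$ be the left quaternionic projective line (pairs $(a,b)\neq 0$ of quaternions modulo $(a,b)\sim(pa,pb)$, $p\in\mathbb H\setminus\{0\}$) with its quotient topology, and let $\pi:\mathbb{CP}^3\to\mathbb{HP}^1$, $\pi[X_0,X_1,X_2,X_3]=[X_0+X_1j,\,X_2+X_3j]$, be the twistor fibration. Let $\mathcal C\subset\mathbb{CP}^3$ be the cubic scroll $X_0X_3^2+X_1^2X_2=0$. Let $G_2$ be the set of double points of $\mathcal C$, i.e. of those $q\in\mathbb{HP}^1$ for which $\pi^{-1}(q)\cap\mathcal C$ consists of exactly two points, and let $G_0$ be the set of those $q\in\mathbb{HP}^1$ with $\#(\pi^{-1}(q)\cap\mathcal C)\neq 3$ and $\pi^{-1}(q)\subset\mathcal C$. Let $\hat{\mathbb C}_i=\mathbb C_i\cup\{\infty\}\subset\mathbb{HP}^1$ be the 2-sphere of the points $z=[1,z]$, $z\in\mathbb C_i$, and $\infty=[0,1]$. Let $S$ be the 2-sphere with six pinched handles, that is, the quotient space of the disjoint union of the sphere $\mathbb C\cup\{\infty\}$ and six closed cylinders $S^1\times[0,1]$, indexed by the pairs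 $(P,z)$ with $P\in\{0,\infty\}$ and $z^3=-1$, in which for the cylinder with index $(P,z)$ the circle $S^1\times\{0\}$ is collapsed to the point $P$ of the sphere and the circle $S^1\times\{1\}$ to the point $z$ of the sphere. Let $A\subset S$ be the set of attaching points $0,\infty$ and $z$ with $z^3=-1$. **Proposition 5.5.** The set $G_2$ is homeomorphic to $S\setminus A$. More precisely, there is a topological embedding $\Phi:S\to\mathbb{HP}^1$ that restricts to the standard map $\mathbb C\cup\{\infty\}\to\hat{\mathbb C}_i$ on the sphere and satisfies $\Phi(A)=G_0$ and $$G_2=\Phi(S)\setminus G_0=\Big(\hat{\mathbb C}_i\cup\bigcup_{P\in\{0,\infty\},\ z^3=-1}\Sigma_{P,z}\Big)\setminus G_0,$$ where $\Sigma_{P,z}\subset\mathbb{HP}^1$ is the image under $\Phi$ of the handle with index $(P,z)$, pinched to $\hat{\mathbb C}_i$ at $P$ and $z$. -/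

import Mathlib

open scoped Quaternion LinearAlgebra.Projectivization

/-- Complex projective space of dimension three. -/
abbrev CP3 : Type := ℙ ℂ (Fin 4 → ℂ)

/-- The left quaternionic projective line: pairs `(a, b) ≠ 0` of quaternions modulo
`(a, b) ∼ (p * a, p * b)` for quaternions `p ≠ 0`. -/
abbrev HP1 : Type := ℙ ℍ[ℝ] (Fin 2 → ℍ[ℝ])

/-- The quotient topology on `HP1`, coming from the nonzero vectors of `ℍ × ℍ`. -/
instance HP1.instTopologicalSpace : TopologicalSpace HP1 :=
  inferInstanceAs (TopologicalSpace (Quotient (projectivizationSetoid ℍ[ℝ] (Fin 2 → ℍ[ℝ]))))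

/-- The quaternion unit `j`. -/
def quatJ : ℍ[ℝ] := ⟨0, 0, 1, 0⟩

theorem coeComplex_add_mul_quatJ (z w : ℂ) :
    (z : ℍ[ℝ]) + (w : ℍ[ℝ]) * quatJ = ⟨z.re, z.im, w.re, w.im⟩ := by
  have h0 : quatJ.re = 0 := rfl
  have h1 : quatJ.imI = 0 := rfl
  have h2 : quatJ.imJ = 1 := rfl
  have h3 : quatJ.imK = 0 := rfl
  ext <;> simp [h0, h1, h2, h3]

/-- The map `(X₀, X₁, X₂, X₃) ↦ (X₀ + X₁ j, X₂ + X₃ j)`, where complex numbers are regarded as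
quaternions via `x + y i ↦ x + y i`. -/
noncomputable def twistorLinear :
    (Fin 4 → ℂ) →ₛₗ[(Quaternion.ofComplex : ℂ →+* ℍ[ℝ])] (Fin 2 → ℍ[ℝ]) where
  toFun X := ![(X 0 : ℍ[ℝ]) + (X 1 : ℍ[ℝ]) * quatJ, (X 2 : ℍ[ℝ]) + (X 3 : ℍ[ℝ]) * quatJ]
  map_add' X Y := by
    ext i : 1
    fin_cases i <;> simp [add_mul] <;> abel
  map_smul' c X := by
    ext i : 1
    fin_cases i <;> simp [mul_add, mul_assoc]

theorem twistorLinear_injective : Function.Injective twistorLinear := by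
  intro X Y h
  have h0 : (X 0 : ℍ[ℝ]) + (X 1 : ℍ[ℝ]) * quatJ = (Y 0 : ℍ[ℝ]) + (Y 1 : ℍ[ℝ]) * quatJ :=
    congrFun h 0
  have h1 : (X 2 : ℍ[ℝ]) + (X 3 : ℍ[ℝ]) * quatJ = (Y 2 : ℍ[ℝ]) + (Y 3 : ℍ[ℝ]) * quatJ :=
    congrFun h 1
  rw [coeComplex_add_mul_quatJ, coeComplex_add_mul_quatJ] at h0 h1
  injection h0 with a b c d
  injection h1 with e f g k
  ext i : 1
  fin_cases i <;> apply Complex.ext <;> assumption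

/-- The twistor fibration `π : CP³ → HP¹`, `[X₀, X₁, X₂, X₃] ↦ [X₀ + X₁ j, X₂ + X₃ j]`. -/
noncomputable def twistorProj : CP3 → HP1 :=
  Projectivization.map twistorLinear twistorLinear_injective

/-- The twistor discriminant locus of a surface `K` of degree `d` in `CP³`: the points whose
twistor fibre does not meet `K` in exactly `d` points. -/
def discriminantLocus (K : Set CP3) (d : ℕ) : Set HP1 :=
  {q | (twistorProj ⁻¹' {q} ∩ K).encard ≠ d}

/-- The set `G₀` of points of the discriminant locus whose whole twistor fibre lies in `K`. -/
def twistorLines (K : Set CP3) (d : ℕ) : Set HP1 :=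
  {q ∈ discriminantLocus K d | twistorProj ⁻¹' {q} ⊆ K}

/-- The set of points whose twistor fibre meets `K` in exactly `n` points. -/
def fibreCount (K : Set CP3) (n : ℕ) : Set HP1 :=
  {q | (twistorProj ⁻¹' {q} ∩ K).encard = n}

/-- The set `G₂` of double points of a cubic surface `K`. -/
def doublePoints (K : Set CP3) : Set HP1 := fibreCount K 2

/-- The cubic scroll `X₀ X₃² + X₁² X₂ = 0`. -/
def cubicScroll : Set CP3 :=
  {p | p.rep 0 * p.rep 3 ^ 2 + p.rep 1 ^ 2 * p.rep 2 = 0}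

theorem mk_mem_cubicScroll (X : Fin 4 → ℂ) (hX : X ≠ 0) :
    Projectivization.mk ℂ X hX ∈ cubicScroll ↔ X 0 * X 3 ^ 2 + X 1 ^ 2 * X 2 = 0 := by
  obtain ⟨a, ha⟩ := Projectivization.exists_smul_eq_mk_rep ℂ X hX
  have e (i : Fin 4) : (Projectivization.mk ℂ X hX).rep i = (a : ℂ) * X i := by
    rw [← ha]; rfl
  have h : ((a : ℂ) * X 0) * ((a : ℂ) * X 3) ^ 2 + ((a : ℂ) * X 1) ^ 2 * ((a : ℂ) * X 2)
      = (a : ℂ) ^ 3 * (X 0 * X 3 ^ 2 + X 1 ^ 2 * X 2) := by ring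
  simp only [cubicScroll, Set.mem_ofPred_eq, e, h]
  simp

/-- The inclusion of the Riemann sphere `Ĉ_i = ℂ ∪ {∞}` in `HP¹`: `z ↦ [1, z]`, `∞ ↦ [0, 1]`. -/
noncomputable def sphereToHP1 : OnePoint ℂ → HP1
  | none => Projectivization.mk ℍ[ℝ] ![0, 1] (fun h => one_ne_zero (congrFun h 1))
  | some z => Projectivization.mk ℍ[ℝ] ![1, (z : ℍ[ℝ])] (fun h => one_ne_zero (congrFun h 0))

/-- The six handles `Σ_{P, z}` are indexed by the pairs of a pole `P ∈ {0, ∞}` and a cube root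
`z` of `-1`. -/
abbrev HandleIndex : Type :=
  ({((0 : ℂ) : OnePoint ℂ), OnePoint.infty} : Set (OnePoint ℂ)) × {z : ℂ // z ^ 3 = -1}

/-- The gluing relation for pinched handles: on the disjoint union of the sphere and of six closed
cylinders `S¹ × [0, 1]`, the boundary circle `S¹ × {0}` of the cylinder with index `(P, z)` is
collapsed to the point `P` of the sphere, and the circle `S¹ × {1}` to the point `z`. -/
inductive PinchRel :
    OnePoint ℂ ⊕ (Σ _ : HandleIndex, Circle × unitInterval) →
    OnePoint ℂ ⊕ (Σ _ : HandleIndex, Circle × unitInterval) → Prop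
  | pole (h : HandleIndex) (c : Circle) : PinchRel (Sum.inr ⟨h, (c, 0)⟩) (Sum.inl h.1.1)
  | root (h : HandleIndex) (c : Circle) :
      PinchRel (Sum.inr ⟨h, (c, 1)⟩) (Sum.inl ((h.2.1 : ℂ) : OnePoint ℂ))

/-- The 2-sphere with six pinched handles, with the quotient topology. -/
abbrev PinchedSphere : Type := Quot PinchRel

/-- The points of the 2-sphere with six pinched handles at which the handles are attached. -/
def attachingPoints : Set PinchedSphere :=
  {x | ∃ h : HandleIndex, x = Quot.mk PinchRel (Sum.inl h.1.1) ∨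
    x = Quot.mk PinchRel (Sum.inl ((h.2.1 : ℂ) : OnePoint ℂ))}

/-! Over $[1, z+wj]$ the twistor fibre is a projective line with parameter $t\in\mathbb
C\cup\{\infty\}$, on which the scroll becomes $t(tw+\bar z)^2+tz-\bar w=0$, and $t=\infty$ is a
solution iff $w=0$.

If $w=0$, the equation is $t(\bar z^2+z)=0$. The solutions are $0$ and $\infty$ unless $\bar
z^2+z=0$, that is $z=0$ or $z^3=-1$, when the whole fibre lies in the scroll. The fibre over
$\infty$ lies in it too. So $G_0$ consists of the attaching points, and the rest of $\hat{\mathbb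
C}_i$ is in $G_2$.

If $w\ne0$, the substitution $s=tw$ gives a monic cubic with coefficients $2\bar z$, $\bar z^2+z$,
$-|w|^2$ (`encard_scrollParams`), and a double point means a double root $a$ and another root $b$.
Vieta's formulas with $b=-2u$, $a=nu$, $\rho=|u|$ force $n$ to be real and $u^3=-\rho^3$, whence
$z=x\cdot 3\rho^2/(2\rho+1)$ with $x^3=-1$ and $|w|^2=2\rho^3(\rho-1)^2/(2\rho+1)^2$
(`normal_form_of_double_root`, converse `double_root_of_normal_form`). For each $x$ this is a family
of circles over $\rho>0$ that shrinks to a point at $\rho=0,1,\infty$: the range $\rho<1$ is the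
handle from $0$ to $x$, the range $\rho>1$ the one from $\infty$ to $x$.

The resulting map from the pinched sphere is continuous and injective. Its source is compact and
$\mathbb{HP}^1$ is Hausdorff (`HP1.t2Space`), so it is an embedding. -/

/-! ### Affine coordinates on the quaternionic projective line -/

/-- The point `[1, z + w j]` of the quaternionic projective line. -/
noncomputable def affinePoint (z w : ℂ) : HP1 :=
  Projectivization.mk ℍ[ℝ] ![1, (z : ℍ[ℝ]) + (w : ℍ[ℝ]) * quatJ]
    (fun h => one_ne_zero (congrFun h 0))

/-- The point `[0, 1]` of the quaternionic projective line. -/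
noncomputable def inftyPoint : HP1 :=
  Projectivization.mk ℍ[ℝ] ![0, 1] (fun h => one_ne_zero (congrFun h 1))

theorem sphereToHP1_coe (z : ℂ) : sphereToHP1 (z : OnePoint ℂ) = affinePoint z 0 := by
  change Projectivization.mk _ _ _ = Projectivization.mk _ _ _
  simp

theorem sphereToHP1_infty : sphereToHP1 OnePoint.infty = inftyPoint := rfl

theorem mk_eq_mk_one_iff {v : Fin 2 → ℍ[ℝ]} (hv : v ≠ 0) (q : ℍ[ℝ])
    (hq : (![1, q] : Fin 2 → ℍ[ℝ]) ≠ 0) :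
    (Projectivization.mk ℍ[ℝ] v hv : HP1) = Projectivization.mk ℍ[ℝ] ![1, q] hq ↔
      v 1 = v 0 * q := by
  rw [Projectivization.mk_eq_mk_iff']
  constructor
  · rintro ⟨a, rfl⟩
    simp
  · intro h
    refine ⟨v 0, ?_⟩
    ext1 i
    fin_cases i <;> simp [h]

theorem mk_eq_inftyPoint_iff {v : Fin 2 → ℍ[ℝ]} (hv : v ≠ 0) :
    (Projectivization.mk ℍ[ℝ] v hv : HP1) = inftyPoint ↔ v 0 = 0 := by
  rw [inftyPoint, Projectivization.mk_eq_mk_iff']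
  constructor
  · rintro ⟨a, rfl⟩
    simp
  · intro h
    refine ⟨v 1, ?_⟩
    ext1 i
    fin_cases i <;> simp [h]

theorem mk_eq_affinePoint_iff {v : Fin 2 → ℍ[ℝ]} (hv : v ≠ 0) (z w : ℂ) :
    (Projectivization.mk ℍ[ℝ] v hv : HP1) = affinePoint z w ↔
      v 1 = v 0 * ((z : ℍ[ℝ]) + (w : ℍ[ℝ]) * quatJ) :=
  mk_eq_mk_one_iff hv _ _

theorem coeComplex_add_mul_quatJ_inj {a b c d : ℂ} :
    (a : ℍ[ℝ]) + (b : ℍ[ℝ]) * quatJ = (c : ℍ[ℝ]) + (d : ℍ[ℝ]) * quatJ ↔ a = c ∧ b = d := by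
  rw [coeComplex_add_mul_quatJ, coeComplex_add_mul_quatJ]
  constructor
  · intro h
    injection h with h1 h2 h3 h4
    exact ⟨Complex.ext h1 h2, Complex.ext h3 h4⟩
  · rintro ⟨rfl, rfl⟩
    rfl

theorem exists_coeComplex_add_mul_quatJ (q : ℍ[ℝ]) :
    ∃ z w : ℂ, q = (z : ℍ[ℝ]) + (w : ℍ[ℝ]) * quatJ :=
  ⟨⟨q.re, q.imI⟩, ⟨q.imJ, q.imK⟩, by rw [coeComplex_add_mul_quatJ]; rfl⟩

/-- The conjugates come from $jz=\bar zj$, the sign from $j^2=-1$. -/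
theorem coeComplex_add_mul_quatJ_mul (a b z w : ℂ) :
    ((a : ℍ[ℝ]) + (b : ℍ[ℝ]) * quatJ) * ((z : ℍ[ℝ]) + (w : ℍ[ℝ]) * quatJ) =
      ((a * z - b * star w : ℂ) : ℍ[ℝ]) + ((a * w + b * star z : ℂ) : ℍ[ℝ]) * quatJ := by
  simp only [coeComplex_add_mul_quatJ]
  refine (QuaternionAlgebra.mk_mul_mk ..).trans ?_
  ext <;> simp <;> ring

theorem affinePoint_inj {z w z' w' : ℂ} :
    affinePoint z w = affinePoint z' w' ↔ z = z' ∧ w = w' := by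
  rw [affinePoint, mk_eq_affinePoint_iff]
  simp [coeComplex_add_mul_quatJ_inj]

theorem affinePoint_ne_inftyPoint (z w : ℂ) : affinePoint z w ≠ inftyPoint := by
  rw [affinePoint, Ne, mk_eq_inftyPoint_iff]
  simp

theorem eq_inftyPoint_or_affinePoint (q : HP1) :
    q = inftyPoint ∨ ∃ z w, q = affinePoint z w := by
  induction q using Projectivization.ind with
  | h v hv =>
    by_cases h0 : v 0 = 0
    · exact Or.inl ((mk_eq_inftyPoint_iff hv).2 h0)
    · obtain ⟨z, w, h⟩ := exists_coeComplex_add_mul_quatJ ((v 0)⁻¹ * v 1)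
      refine Or.inr ⟨z, w, (mk_eq_affinePoint_iff hv z w).2 ?_⟩
      rw [← h, mul_inv_cancel_left₀ h0]

theorem twistorProj_mk_eq_affinePoint_iff {X : Fin 4 → ℂ} (hX : X ≠ 0) (z w : ℂ) :
    twistorProj (Projectivization.mk ℂ X hX) = affinePoint z w ↔
      X 2 = X 0 * z - X 1 * star w ∧ X 3 = X 0 * w + X 1 * star z := by
  rw [twistorProj, Projectivization.map_mk, mk_eq_affinePoint_iff]
  change (X 2 : ℍ[ℝ]) + (X 3 : ℍ[ℝ]) * quatJ = ((X 0 : ℍ[ℝ]) + (X 1 : ℍ[ℝ]) * quatJ) * _ ↔ _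
  rw [coeComplex_add_mul_quatJ_mul, coeComplex_add_mul_quatJ_inj]

theorem twistorProj_mk_eq_inftyPoint_iff {X : Fin 4 → ℂ} (hX : X ≠ 0) :
    twistorProj (Projectivization.mk ℂ X hX) = inftyPoint ↔ X 0 = 0 ∧ X 1 = 0 := by
  rw [twistorProj, Projectivization.map_mk, mk_eq_inftyPoint_iff]
  change (X 0 : ℍ[ℝ]) + (X 1 : ℍ[ℝ]) * quatJ = 0 ↔ _
  rw [show (0 : ℍ[ℝ]) = ((0 : ℂ) : ℍ[ℝ]) + ((0 : ℂ) : ℍ[ℝ]) * quatJ by simp,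
    coeComplex_add_mul_quatJ_inj]

/-! ### The scroll restricted to a twistor fibre -/

/-- A parametrization of the twistor fibre over `[1, z + w j]` by `ℂ ∪ {∞}`. -/
noncomputable def fibrePoint (z w : ℂ) : Option ℂ → CP3
  | none => Projectivization.mk ℂ ![1, 0, z, w] (fun h => one_ne_zero (congrFun h 0))
  | some t => Projectivization.mk ℂ ![t, 1, t * z - star w, t * w + star z]
      (fun h => one_ne_zero (congrFun h 1))

theorem fibrePoint_injective (z w : ℂ) : Function.Injective (fibrePoint z w) := by
  rintro (_ | t) (_ | t') h
  · rfl
  · obtain ⟨a, ha⟩ := (Projectivization.mk_eq_mk_iff' _ _ _ _ _).1 h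
    have h0 := congrFun ha 0
    have h1 := congrFun ha 1
    simp at h0 h1
    simp [h1] at h0
  · obtain ⟨a, ha⟩ := (Projectivization.mk_eq_mk_iff' _ _ _ _ _).1 h
    have h1 := congrFun ha 1
    simp at h1
  · obtain ⟨a, ha⟩ := (Projectivization.mk_eq_mk_iff' _ _ _ _ _).1 h
    have h0 := congrFun ha 0
    have h1 := congrFun ha 1
    simp at h0 h1
    rw [h1, one_mul] at h0
    rw [h0]

theorem range_fibrePoint (z w : ℂ) :
    Set.range (fibrePoint z w) = twistorProj ⁻¹' {affinePoint z w} := by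
  ext p
  simp only [Set.mem_range, Set.mem_preimage, Set.mem_singleton_iff]
  constructor
  · rintro ⟨_ | t, rfl⟩
    · refine (twistorProj_mk_eq_affinePoint_iff _ z w).2 ?_
      simp
    · refine (twistorProj_mk_eq_affinePoint_iff _ z w).2 ?_
      simp
  · induction p using Projectivization.ind with
    | h X hX =>
      intro h
      obtain ⟨h2, h3⟩ := (twistorProj_mk_eq_affinePoint_iff hX z w).1 h
      by_cases h1 : X 1 = 0
      · refine ⟨none, ((Projectivization.mk_eq_mk_iff' _ _ _ _ _).2 ⟨X 0, ?_⟩).symm⟩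
        ext i
        fin_cases i <;> simp [h1, h2, h3]
      · refine ⟨some (X 0 / X 1), ((Projectivization.mk_eq_mk_iff' _ _ _ _ _).2 ⟨X 1, ?_⟩).symm⟩
        ext i
        fin_cases i <;> simp [h2, h3] <;> field_simp

/-- The parameters of the points of the cubic scroll on the twistor fibre over `[1, z + w j]`. -/
def scrollParams (z w : ℂ) : Set (Option ℂ) := fibrePoint z w ⁻¹' cubicScroll

theorem none_mem_scrollParams {z w : ℂ} : none ∈ scrollParams z w ↔ w = 0 := by
  refine (mk_mem_cubicScroll _ _).trans ?_
  simp

theorem some_mem_scrollParams {z w t : ℂ} :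
    some t ∈ scrollParams z w ↔ t * (t * w + star z) ^ 2 + (t * z - star w) = 0 := by
  refine (mk_mem_cubicScroll _ _).trans ?_
  simp

theorem encard_fibre_inter (z w : ℂ) :
    (twistorProj ⁻¹' {affinePoint z w} ∩ cubicScroll).encard = (scrollParams z w).encard := by
  rw [← range_fibrePoint, Set.inter_comm, ← Set.image_preimage_eq_inter_range,
    (fibrePoint_injective z w).encard_image, scrollParams]

theorem fibre_subset_iff (z w : ℂ) :
    twistorProj ⁻¹' {affinePoint z w} ⊆ cubicScroll ↔ scrollParams z w = Set.univ := by
  rw [← range_fibrePoint, Set.range_subset_iff, scrollParams, Set.eq_univ_iff_forall]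
  rfl

theorem scrollParams_eq_univ_iff {z w : ℂ} :
    scrollParams z w = Set.univ ↔ w = 0 ∧ star z ^ 2 + z = 0 := by
  constructor
  · intro h
    have hn : none ∈ scrollParams z w := h ▸ Set.mem_univ _
    have h1 : some 1 ∈ scrollParams z w := h ▸ Set.mem_univ _
    rw [none_mem_scrollParams] at hn
    rw [some_mem_scrollParams] at h1
    subst hn
    simpa using h1
  · rintro ⟨rfl, h⟩
    rw [Set.eq_univ_iff_forall]
    rintro (_ | t)
    · rw [none_mem_scrollParams]
    · rw [some_mem_scrollParams, star_zero]
      linear_combination t * h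

theorem affinePoint_mem_twistorLines_iff {z w : ℂ} :
    affinePoint z w ∈ twistorLines cubicScroll 3 ↔ w = 0 ∧ star z ^ 2 + z = 0 := by
  simp only [twistorLines, discriminantLocus, Set.mem_ofPred_eq, encard_fibre_inter,
    fibre_subset_iff, scrollParams_eq_univ_iff]
  -- A fibre contained in the scroll is infinite, so it does not have exactly three points.
  refine and_iff_right_of_imp fun h => ?_
  rw [scrollParams_eq_univ_iff.2 h, Set.encard_univ, ENat.card_eq_top_of_infinite]
  simp

theorem fibre_infty_subset : twistorProj ⁻¹' {inftyPoint} ⊆ cubicScroll := by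
  intro p
  induction p using Projectivization.ind with
  | h X hX =>
    intro h
    obtain ⟨h0, h1⟩ := (twistorProj_mk_eq_inftyPoint_iff hX).1 h
    rw [mk_mem_cubicScroll, h0, h1]
    ring

theorem encard_fibre_infty : (twistorProj ⁻¹' {inftyPoint}).encard = ⊤ := by
  let f : ℂ → CP3 := fun t => Projectivization.mk ℂ ![0, 0, 1, t]
    (fun h => one_ne_zero (congrFun h 2))
  have hf : Function.Injective f := by
    intro t t' h
    obtain ⟨a, ha⟩ := (Projectivization.mk_eq_mk_iff' _ _ _ _ _).1 h
    have h0 := congrFun ha 2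
    have h1 := congrFun ha 3
    simp at h0 h1
    rw [h0, one_mul] at h1
    exact h1.symm
  rw [Set.encard_eq_top_iff]
  refine (Set.infinite_range_of_injective hf).mono ?_
  rintro _ ⟨t, rfl⟩
  exact (twistorProj_mk_eq_inftyPoint_iff _).2 ⟨rfl, rfl⟩

theorem inftyPoint_mem_twistorLines : inftyPoint ∈ twistorLines cubicScroll 3 := by
  refine ⟨?_, fibre_infty_subset⟩
  simp only [discriminantLocus, Set.mem_ofPred_eq, Set.inter_eq_left.2 fibre_infty_subset,
    encard_fibre_infty]
  simp

theorem inftyPoint_notMem_doublePoints : inftyPoint ∉ doublePoints cubicScroll := by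
  simp only [doublePoints, fibreCount, Set.mem_ofPred_eq, Set.inter_eq_left.2 fibre_infty_subset,
    encard_fibre_infty]
  simp

/-- Taking norms in $\bar z^2=-z$ gives $|z|=1$ for $z\neq 0$; then $\bar z=z^{-1}$ and the equation
becomes $z^3=-1$. -/
theorem star_sq_add_eq_zero_iff {z : ℂ} : star z ^ 2 + z = 0 ↔ z = 0 ∨ z ^ 3 = -1 := by
  have key : z * star z = ((‖z‖ ^ 2 : ℝ) : ℂ) := by
    simpa using Complex.mul_conj' z
  constructor
  · intro h
    by_cases hz : z = 0
    · exact Or.inl hz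
    right
    have hn : ‖z‖ ^ 2 = ‖z‖ := by
      have : star z ^ 2 = -z := by linear_combination h
      simpa using congrArg norm this
    have h1 : ‖z‖ = 1 := by
      have := norm_ne_zero_iff.2 hz
      field_simp at hn
      exact hn
    rw [h1] at key
    have : z * star z = 1 := by simpa using key
    linear_combination z ^ 2 * h - (z * star z + 1) * this
  · rintro (rfl | h)
    · simp
    · have h1 : ‖z‖ = 1 := by
        have : ‖z‖ ^ 3 = 1 := by simpa using congrArg norm h
        exact (pow_eq_one_iff_of_nonneg (norm_nonneg z) (by norm_num)).1 this
      rw [h1] at key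
      have : z * star z = 1 := by simpa using key
      have hz : z ≠ 0 := by rintro rfl; simp at h1
      apply mul_left_cancel₀ (pow_ne_zero 2 hz)
      linear_combination (z * star z + 1) * this + h

theorem affinePoint_zero_mem_doublePoints_iff {z : ℂ} :
    affinePoint z 0 ∈ doublePoints cubicScroll ↔ star z ^ 2 + z ≠ 0 := by
  simp only [doublePoints, fibreCount, Set.mem_ofPred_eq, encard_fibre_inter]
  by_cases h : star z ^ 2 + z = 0
  · rw [scrollParams_eq_univ_iff.2 ⟨rfl, h⟩, Set.encard_univ, ENat.card_eq_top_of_infinite]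
    simpa using h
  · have : scrollParams z 0 = {none, some 0} := by
      ext (_ | t)
      · simp [none_mem_scrollParams]
      · rw [some_mem_scrollParams]
        have e : t * (t * 0 + star z) ^ 2 + (t * z - star 0) = t * (star z ^ 2 + z) := by
          rw [star_zero]; ring
        rw [e, mul_eq_zero, or_iff_left h]
        simp
    rw [this, Set.encard_pair (by simp)]
    simpa using h

/-! ### Cubics with a double root -/

theorem exists_cubic_factorization (A B C : ℂ) :
    ∃ x y z : ℂ, ∀ s, s ^ 3 + A * s ^ 2 + B * s + C = (s - x) * (s - y) * (s - z) := by
  obtain ⟨x, hx⟩ := Complex.exists_root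
    (f := (Polynomial.X ^ 3 + Polynomial.C A * Polynomial.X ^ 2 + Polynomial.C B * Polynomial.X +
      Polynomial.C C)) (by
        have : (Polynomial.X ^ 3 + Polynomial.C A * Polynomial.X ^ 2 +
          Polynomial.C B * Polynomial.X + Polynomial.C C : Polynomial ℂ).degree = 3 := by
          compute_degree!
        rw [this]
        norm_num)
  simp only [Polynomial.IsRoot.def, Polynomial.eval_add, Polynomial.eval_mul,
    Polynomial.eval_pow, Polynomial.eval_X, Polynomial.eval_C] at hx
  -- $d$ is a square root of the discriminant of the quadratic left after division by $s-x$.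
  obtain ⟨d, hd⟩ := IsAlgClosed.exists_pow_nat_eq
    ((A + x) ^ 2 - 4 * (B + x * (A + x))) (n := 2) two_pos
  refine ⟨x, (-(A + x) + d) / 2, (-(A + x) - d) / 2, fun s => ?_⟩
  linear_combination hx + (s - x) / 4 * hd

/-- A monic complex cubic has exactly two roots iff it has a double root and a different simple
one. -/
theorem encard_cubic_roots_eq_two_iff (A B C : ℂ) :
    {s : ℂ | s ^ 3 + A * s ^ 2 + B * s + C = 0}.encard = 2 ↔
      ∃ a b : ℂ, a ≠ b ∧ A = -(2 * a + b) ∧ B = a ^ 2 + 2 * a * b ∧ C = -(a ^ 2 * b) := by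
  constructor
  · obtain ⟨x, y, z, h⟩ := exists_cubic_factorization A B C
    -- Values at $0$ and $\pm1$ are enough to recover Vieta's formulas.
    have hC := h 0
    have h1 := h 1
    have h2 := h (-1)
    have eC : C = -(x * y * z) := by linear_combination hC
    have eA : A = -(x + y + z) := by linear_combination (h1 + h2) / 2 - hC
    have eB : B = x * y + y * z + x * z := by linear_combination (h1 - h2) / 2
    have hs : {s : ℂ | s ^ 3 + A * s ^ 2 + B * s + C = 0} = {x, y, z} := by
      ext s
      simp [h, sub_eq_zero, or_assoc]
    rw [hs]
    intro hcard
    by_cases hxy : x = y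
    · subst hxy
      refine ⟨x, z, ?_, ?_, ?_, ?_⟩
      · rintro rfl
        simp at hcard
      all_goals first | rw [eA] | rw [eB] | rw [eC]
      all_goals ring
    by_cases hyz : y = z
    · subst hyz
      refine ⟨y, x, Ne.symm hxy, ?_, ?_, ?_⟩
      all_goals first | rw [eA] | rw [eB] | rw [eC]
      all_goals ring
    by_cases hxz : x = z
    · subst hxz
      refine ⟨x, y, hxy, ?_, ?_, ?_⟩
      all_goals first | rw [eA] | rw [eB] | rw [eC]
      all_goals ring
    rw [Set.encard_eq_three.2 ⟨x, y, z, hxy, hxz, hyz, rfl⟩] at hcard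
    norm_num at hcard
  · rintro ⟨a, b, hab, rfl, rfl, rfl⟩
    rw [← Set.encard_pair hab]
    congr 1
    ext s
    have e : s ^ 3 + -(2 * a + b) * s ^ 2 + (a ^ 2 + 2 * a * b) * s + -(a ^ 2 * b)
      = (s - a) ^ 2 * (s - b) := by ring
    simp only [Set.mem_ofPred_eq, e]
    simp [sub_eq_zero]

/-- The fibre equation multiplied by $w$ is monic in $s=tw$, with a real constant term. -/
theorem encard_scrollParams {z w : ℂ} (hw : w ≠ 0) :
    (scrollParams z w).encard = {s : ℂ | s ^ 3 + (2 * star z) * s ^ 2 + (star z ^ 2 + z) * s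
      + -((‖w‖ ^ 2 : ℝ) : ℂ) = 0}.encard := by
  have key : w * star w = ((‖w‖ ^ 2 : ℝ) : ℂ) := by
    simpa using Complex.mul_conj' w
  have hinj : Function.Injective fun s : ℂ => (some (s / w) : Option ℂ) := by
    intro s s' h
    simpa [hw] using h
  rw [← hinj.encard_image]
  congr 1
  ext (_ | t)
  · simp [none_mem_scrollParams, hw]
  · rw [some_mem_scrollParams]
    have e (s : ℂ) : (some (s / w) = some t) ↔ s = t * w := by
      rw [Option.some_inj, div_eq_iff hw]
    simp only [Set.mem_image, e, exists_eq_right, Set.mem_ofPred_eq, ← key]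
    rw [show (t * w) ^ 3 + 2 * star z * (t * w) ^ 2 + (star z ^ 2 + z) * (t * w) + -(w * star w)
      = w * (t * (t * w + star z) ^ 2 + (t * z - star w)) by ring, mul_eq_zero]
    simp [hw]

theorem normal_form_of_double_root {z a b : ℂ} {r : ℝ} (hr : 0 < r)
    (hA : 2 * star z = -(2 * a + b)) (hB : star z ^ 2 + z = a ^ 2 + 2 * a * b)
    (hC : -(r : ℂ) = -(a ^ 2 * b)) :
    ∃ ρ : ℝ, 0 < ρ ∧ ∃ x : ℂ, x ^ 3 = -1 ∧ z = x * (3 * ρ ^ 2 / (2 * ρ + 1) : ℝ) ∧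
      r = 2 * ρ ^ 3 * (ρ - 1) ^ 2 / (2 * ρ + 1) ^ 2 := by
  have hb : b ≠ 0 := by
    rintro rfl
    simp at hC
    exact hr.ne' hC
  -- With this scaling the quadratic coefficient reads $\bar z=(1-n)u$.
  obtain ⟨u, rfl⟩ : ∃ u, b = -2 * u := ⟨-b / 2, by ring⟩
  have hu : u ≠ 0 := by rintro rfl; simp at hb
  obtain ⟨n, rfl⟩ : ∃ n, a = n * u := ⟨a / u, by field_simp⟩
  have hn : n ≠ 0 := by
    rintro rfl
    simp at hC
    exact hr.ne' hC
  have hv : star z = (1 - n) * u := by linear_combination hA / 2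
  have hz : z = (1 - star n) * star u := by
    rw [← star_star z, hv]
    simp
  have hρ : 0 < ‖u‖ := norm_pos_iff.2 hu
  have huu : u * star u = (‖u‖ : ℂ) ^ 2 := by simpa using Complex.mul_conj' u
  have hnn : n * star n = (‖n‖ : ℂ) ^ 2 := by simpa using Complex.mul_conj' n
  have hC' : (r : ℂ) = -2 * n ^ 2 * u ^ 3 := by linear_combination -hC
  have hr' : r = 2 * ‖n‖ ^ 2 * ‖u‖ ^ 3 := by
    have := congrArg norm hC'
    simpa [abs_of_pos hr] using this
  set ρ := ‖u‖
  -- Eliminating $\bar z$ from `hB` gives $z=-u^2(1+2n)$, to be compared with the conjugate of `hv`.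
  -- Multiplication by $-2n^2u$ turns $u^3$ into $r$ and $u\bar u$ into $\rho^2$, so the phase of
  -- $u$ drops out.
  have h1 : (r : ℂ) * (1 + 2 * n) = 2 * n ^ 2 * (1 - star n) * ρ ^ 2 := by
    have h2 : (1 - star n) * star u = -u ^ 2 * (1 + 2 * n) := by
      rw [← hz]
      linear_combination hB - (star z + (1 - n) * u) * hv
    rw [hC']
    linear_combination -2 * n ^ 2 * u * h2 + 2 * n ^ 2 * (1 - star n) * huu
  have hρc : (ρ : ℂ) ≠ 0 := by exact_mod_cast hρ.ne'
  have h2 : star n * ρ * (1 + 2 * n) = n * (1 - star n) := by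
    have e : (r : ℂ) = 2 * (n * star n) * ρ ^ 3 := by
      rw [hnn, hr']
      push_cast
      ring
    rw [e] at h1
    apply mul_left_cancel₀ (mul_ne_zero hn (pow_ne_zero 2 hρc))
    linear_combination h1 / 2
  -- In $\bar n\rho=n-|n|^2(1+2\rho)$ the last term is real, so the imaginary parts give
  -- $(1+\rho)\operatorname{Im}n=0$.
  have him : n.im = 0 := by
    have h3 : star n * ρ = n - (‖n‖ : ℂ) ^ 2 * (1 + 2 * ρ) := by
      rw [← hnn]
      linear_combination h2
    have h4 := congrArg Complex.im h3
    have e : (n - (‖n‖ : ℂ) ^ 2 * (1 + 2 * ρ)).im = n.im := by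
      rw [show (‖n‖ : ℂ) ^ 2 * (1 + 2 * ρ) = ((‖n‖ ^ 2 * (1 + 2 * ρ) : ℝ) : ℂ) by push_cast; ring,
        Complex.sub_im, Complex.ofReal_im, sub_zero]
    rw [e] at h4
    have h5 : n.im * (1 + ρ) = 0 := by
      simp at h4
      linear_combination -h4
    exact (mul_eq_zero.1 h5).resolve_right (by positivity)
  obtain ⟨m, rfl⟩ : ∃ m : ℝ, n = m := ⟨n.re, Complex.ext rfl (by simpa using him)⟩
  have hm : m ≠ 0 := by exact_mod_cast hn
  have h3 : ρ * (1 + 2 * m) = 1 - m := by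
    have h4 : (m : ℂ) * ρ * (1 + 2 * m) = m * (1 - m) := by simpa using h2
    have h5 : m * ρ * (1 + 2 * m) = m * (1 - m) := by exact_mod_cast h4
    apply mul_left_cancel₀ hm
    linear_combination h5
  have hm' : m = (1 - ρ) / (2 * ρ + 1) := by
    rw [eq_div_iff (by positivity)]
    linear_combination h3
  have hr2 : r = 2 * m ^ 2 * ρ ^ 3 := by simpa using hr'
  refine ⟨ρ, hρ, star u / ρ, ?_, ?_, ?_⟩
  · have h6 : u ^ 3 = -(ρ : ℂ) ^ 3 := by
      rw [hr2] at hC'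
      push_cast at hC'
      apply mul_left_cancel₀ (pow_ne_zero 2 hn)
      linear_combination (1 / 2 : ℂ) * hC'
    have h7 : star u ^ 3 = -(ρ : ℂ) ^ 3 := by simpa using congrArg star h6
    rw [div_pow, h7, neg_div, div_self (pow_ne_zero 3 hρc)]
  · have h8 : (1 - m) * ρ = 3 * ρ ^ 2 / (2 * ρ + 1) := by
      rw [hm']
      field_simp
      ring
    rw [← h8, hz]
    push_cast
    field_simp
    simp [mul_comm]
  · rw [hr2, hm']
    field_simp
    ring

theorem double_root_of_normal_form {z x : ℂ} {r ρ : ℝ} (hρ : 0 < ρ) (hx : x ^ 3 = -1)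
    (hz : z = x * (3 * ρ ^ 2 / (2 * ρ + 1) : ℝ))
    (hr : r = 2 * ρ ^ 3 * (ρ - 1) ^ 2 / (2 * ρ + 1) ^ 2) :
    ∃ a b : ℂ, a ≠ b ∧ 2 * star z = -(2 * a + b) ∧ star z ^ 2 + z = a ^ 2 + 2 * a * b ∧
      -(r : ℂ) = -(a ^ 2 * b) := by
  have h2 : (2 * ρ + 1 : ℝ) ≠ 0 := by positivity
  have hρc : (ρ : ℂ) ≠ 0 := by exact_mod_cast hρ.ne'
  have hc : (2 * ρ + 1 : ℂ) ≠ 0 := by exact_mod_cast h2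
  have hxx : star x ^ 2 + x = 0 := star_sq_add_eq_zero_iff.2 (Or.inr hx)
  have hy : star x ^ 3 = -1 := by simpa using congrArg star hx
  have hy0 : star x ≠ 0 := by intro h; rw [h] at hy; norm_num at hy
  have hsz : star z = star x * (3 * ρ ^ 2 / (2 * ρ + 1) : ℝ) := by
    rw [hz]
    simp
  -- These are $nu$ and $-2u$ for $u=\bar x\rho$ and $n=(1-\rho)/(2\rho+1)$.
  refine ⟨((1 - ρ) / (2 * ρ + 1) : ℝ) * (star x * ρ), -2 * (star x * ρ), ?_, ?_, ?_, ?_⟩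
  · intro h
    -- Equal roots would mean $n=-2$, hence $\rho=-1$: triple roots do not occur.
    have h3 : (((1 - ρ) / (2 * ρ + 1) : ℝ) : ℂ) = ((-2 : ℝ) : ℂ) := by
      apply mul_right_cancel₀ (mul_ne_zero hy0 hρc)
      rw [h]
      push_cast
      ring
    have h4 := Complex.ofReal_injective h3
    rw [div_eq_iff h2] at h4
    linarith
  · rw [hsz]
    push_cast
    field_simp
    ring
  · have e : star z ^ 2 + z = star x ^ 2 * ((3 * ρ ^ 2 / (2 * ρ + 1) : ℝ) ^ 2 -
        (3 * ρ ^ 2 / (2 * ρ + 1) : ℝ)) := by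
      rw [hsz, hz]
      linear_combination (((3 * ρ ^ 2 / (2 * ρ + 1) : ℝ)) : ℂ) * hxx
    rw [e]
    push_cast
    field_simp
    ring
  · rw [hr, show (((1 - ρ) / (2 * ρ + 1) : ℝ) * (star x * ρ)) ^ 2 * (-2 * (star x * ρ)) =
      star x ^ 3 * (((1 - ρ) / (2 * ρ + 1) : ℝ) ^ 2 * (-2) * (ρ : ℂ) ^ 3) by ring, hy]
    push_cast
    field_simp
    ring

theorem affinePoint_mem_doublePoints_iff {z w : ℂ} (hw : w ≠ 0) :
    affinePoint z w ∈ doublePoints cubicScroll ↔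
      ∃ ρ : ℝ, 0 < ρ ∧ ∃ x : ℂ, x ^ 3 = -1 ∧ z = x * (3 * ρ ^ 2 / (2 * ρ + 1) : ℝ) ∧
        ‖w‖ ^ 2 = 2 * ρ ^ 3 * (ρ - 1) ^ 2 / (2 * ρ + 1) ^ 2 := by
  simp only [doublePoints, fibreCount, Set.mem_ofPred_eq, encard_fibre_inter]
  rw [encard_scrollParams hw]
  refine (encard_cubic_roots_eq_two_iff _ _ _).trans ⟨?_, ?_⟩
  · rintro ⟨a, b, -, hA, hB, hC⟩
    exact normal_form_of_double_root (by positivity) hA hB hC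
  · rintro ⟨ρ, hρ, x, hx, hz, hr⟩
    exact double_root_of_normal_form hρ hx hz hr

/-! ### Topology of the quaternionic projective line -/

theorem continuous_mk_HP1 {Y : Type*} [TopologicalSpace Y] {f : Y → Fin 2 → ℍ[ℝ]}
    (hf : Continuous f) (h0 : ∀ y, f y ≠ 0) :
    Continuous fun y => (Projectivization.mk ℍ[ℝ] (f y) (h0 y) : HP1) := by
  have h : Continuous fun v : {v : Fin 2 → ℍ[ℝ] // v ≠ 0} =>
      (Projectivization.mk ℍ[ℝ] v.1 v.2 : HP1) := continuous_quot_mk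
  exact h.comp (hf.subtype_mk h0)

theorem continuous_coeComplex_quaternion : Continuous fun z : ℂ => (z : ℍ[ℝ]) :=
  Quaternion.ofComplex.toLinearMap.continuous_of_finiteDimensional

theorem continuous_twistorProj_mk {Y : Type*} [TopologicalSpace Y] {f : Y → Fin 4 → ℂ}
    (hf : Continuous f) (h0 : ∀ y, f y ≠ 0) :
    Continuous fun y => twistorProj (Projectivization.mk ℂ (f y) (h0 y)) := by
  have hc (i : Fin 4) : Continuous fun y => ((f y i : ℂ) : ℍ[ℝ]) :=
    continuous_coeComplex_quaternion.comp ((continuous_apply i).comp hf)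
  have h1 : Continuous fun y => twistorLinear (f y) := by
    refine continuous_pi fun i => ?_
    fin_cases i
    · exact (hc 0).add ((hc 1).mul continuous_const)
    · exact (hc 2).add ((hc 3).mul continuous_const)
  exact continuous_mk_HP1 h1 fun y h => h0 y (twistorLinear_injective (h.trans (map_zero _).symm))

/-- The invariants `(‖a‖², a* b) / (‖a‖² + ‖b‖²)` of the point `[a, b]` of the quaternionic
projective line. -/
noncomputable def HP1.invariants : HP1 → ℝ × ℍ[ℝ] :=
  Projectivization.lift
    (fun v => (‖v.1 0‖ ^ 2 / (‖v.1 0‖ ^ 2 + ‖v.1 1‖ ^ 2),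
      (‖v.1 0‖ ^ 2 + ‖v.1 1‖ ^ 2)⁻¹ • (star (v.1 0) * v.1 1))) (by
    rintro ⟨a, ha⟩ ⟨b, hb⟩ t h
    obtain rfl : a = t • b := h
    have ht : t ≠ 0 := by rintro rfl; simp at ha
    have ht' : ‖t‖ ^ 2 ≠ 0 := pow_ne_zero 2 (norm_ne_zero_iff.2 ht)
    simp only [Pi.smul_apply, smul_eq_mul, norm_mul, mul_pow, ← mul_add, star_mul]
    congr 1
    · rw [mul_div_mul_left _ _ ht']
    · have e : star (b 0) * star t * (t * b 1) = ‖t‖ ^ 2 • (star (b 0) * b 1) := by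
        rw [mul_assoc, ← mul_assoc (star t), Quaternion.star_mul_self,
          Quaternion.normSq_eq_norm_mul_self, Quaternion.coe_mul_eq_smul, mul_smul_comm, sq]
      rw [e, smul_smul, mul_inv, mul_right_comm, inv_mul_cancel₀ ht', one_mul])

theorem HP1.continuous_invariants : Continuous HP1.invariants := by
  refine continuous_quot_lift _ ?_
  have h0 : Continuous fun v : {v : Fin 2 → ℍ[ℝ] // v ≠ 0} => v.1 0 :=
    (continuous_apply 0).comp continuous_subtype_val
  have h1 : Continuous fun v : {v : Fin 2 → ℍ[ℝ] // v ≠ 0} => v.1 1 :=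
    (continuous_apply 1).comp continuous_subtype_val
  have hN : Continuous fun v : {v : Fin 2 → ℍ[ℝ] // v ≠ 0} => ‖v.1 0‖ ^ 2 + ‖v.1 1‖ ^ 2 :=
    (h0.norm.pow 2).add (h1.norm.pow 2)
  have hN0 (v : {v : Fin 2 → ℍ[ℝ] // v ≠ 0}) : ‖v.1 0‖ ^ 2 + ‖v.1 1‖ ^ 2 ≠ 0 := by
    intro h
    have e0 : v.1 0 = 0 := by
      have : ‖v.1 0‖ ^ 2 = 0 := by nlinarith [sq_nonneg ‖v.1 0‖, sq_nonneg ‖v.1 1‖]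
      simpa using this
    have e1 : v.1 1 = 0 := by
      have : ‖v.1 1‖ ^ 2 = 0 := by nlinarith [sq_nonneg ‖v.1 0‖, sq_nonneg ‖v.1 1‖]
      simpa using this
    refine v.2 (funext fun i => ?_)
    fin_cases i <;> assumption
  exact ((h0.norm.pow 2).div hN hN0).prodMk ((hN.inv₀ hN0).smul (h0.star.mul h1))

/-- The invariants are two entries of the projection matrix of the line; their quotient recovers the
affine coordinate, and the first one vanishes only at $\infty$. -/
theorem HP1.invariants_injective : Function.Injective HP1.invariants := by
  have hi : HP1.invariants inftyPoint = (0, 0) := by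
    simp [HP1.invariants, inftyPoint]
  have ha (z w : ℂ) : HP1.invariants (affinePoint z w) =
      ((1 + ‖(z : ℍ[ℝ]) + (w : ℍ[ℝ]) * quatJ‖ ^ 2)⁻¹,
        (1 + ‖(z : ℍ[ℝ]) + (w : ℍ[ℝ]) * quatJ‖ ^ 2)⁻¹ • ((z : ℍ[ℝ]) + (w : ℍ[ℝ]) * quatJ)) := by
    simp [HP1.invariants, affinePoint]
  have hpos (q : ℍ[ℝ]) : (1 + ‖q‖ ^ 2)⁻¹ ≠ 0 := by positivity
  intro p q h
  rcases eq_inftyPoint_or_affinePoint p with rfl | ⟨z, w, rfl⟩ <;>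
    rcases eq_inftyPoint_or_affinePoint q with rfl | ⟨z', w', rfl⟩
  · rfl
  · rw [hi, ha] at h
    exact absurd (congrArg Prod.fst h).symm (hpos _)
  · rw [hi, ha] at h
    exact absurd (congrArg Prod.fst h) (hpos _)
  · rw [ha, ha] at h
    have h1 := congrArg Prod.fst h
    have h2 := congrArg Prod.snd h
    dsimp only at h1 h2
    rw [h1] at h2
    exact affinePoint_inj.2 (coeComplex_add_mul_quatJ_inj.1 (smul_right_injective _ (hpos _) h2))

theorem HP1.t2Space : T2Space HP1 :=
  T2Space.of_injective_continuous HP1.invariants_injective HP1.continuous_invariants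

theorem continuous_sphereToHP1 : Continuous sphereToHP1 := by
  rw [OnePoint.continuous_iff]
  have h1 (z : ℂ) : (![1, 0, z, 0] : Fin 4 → ℂ) ≠ 0 := fun h => one_ne_zero (congrFun h 0)
  have h2 (z : ℂ) : (![z, 0, 1, 0] : Fin 4 → ℂ) ≠ 0 := fun h => one_ne_zero (congrFun h 2)
  have e1 (z : ℂ) : sphereToHP1 z = twistorProj (Projectivization.mk ℂ _ (h1 z)) := by
    rw [sphereToHP1_coe, eq_comm, twistorProj_mk_eq_affinePoint_iff]
    simp
  have c1 := continuous_twistorProj_mk (f := fun z : ℂ => ![1, 0, z, 0]) (by fun_prop) h1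
  have c2 := continuous_twistorProj_mk (f := fun z : ℂ => ![z, 0, 1, 0]) (by fun_prop) h2
  constructor
  · have e2 : sphereToHP1 OnePoint.infty = twistorProj (Projectivization.mk ℂ _ (h2 0)) := by
      rw [sphereToHP1_infty, eq_comm, twistorProj_mk_eq_inftyPoint_iff]
      simp
    -- Near $\infty$ the sphere is read in the chart $[z^{-1},1]$.
    rw [e2, Filter.coclosedCompact_eq_cocompact, ← Metric.cobounded_eq_cocompact]
    refine ((c2.tendsto 0).comp Filter.tendsto_inv₀_cobounded).congr' ?_
    filter_upwards [(Metric.cobounded_eq_cocompact (α := ℂ)).symm ▸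
      (isCompact_singleton (x := (0 : ℂ))).compl_mem_cocompact] with z hz
    have hz0 : z ≠ 0 := hz
    rw [sphereToHP1_coe]
    refine (twistorProj_mk_eq_affinePoint_iff (h2 z⁻¹) _ _).2 ?_
    simp [hz0]
  · simpa only [e1] using c1

theorem sphereToHP1_injective : Function.Injective sphereToHP1 := by
  intro p q h
  induction p using OnePoint.rec <;> induction q using OnePoint.rec
  · rfl
  · rw [sphereToHP1_coe, sphereToHP1_infty] at h
    exact absurd h.symm (affinePoint_ne_inftyPoint _ _)
  · rw [sphereToHP1_coe, sphereToHP1_infty] at h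
    exact absurd h (affinePoint_ne_inftyPoint _ _)
  · rw [sphereToHP1_coe, sphereToHP1_coe, affinePoint_inj] at h
    rw [h.1]

/-! ### The handles -/

/-- Homogeneous coordinates of the handle joining `0` and `z`. -/
noncomputable def zeroHandleVec (z : ℂ) (y : Circle × unitInterval) : Fin 4 → ℂ :=
  ![(2 * (y.2 : ℝ) + 1 : ℝ), 0, (3 * (y.2 : ℝ) ^ 2 : ℝ) * z,
    (√2 * ((y.2 : ℝ) * √(y.2 : ℝ)) * (1 - (y.2 : ℝ)) : ℝ) * (y.1 : ℂ)]

/-- Homogeneous coordinates of the handle joining `∞` and `z`. -/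
noncomputable def inftyHandleVec (z : ℂ) (y : Circle × unitInterval) : Fin 4 → ℂ :=
  -- This is $(1,0,z,w)$ at $\rho=1/t$, multiplied by $t^{3/2}(2+t)$, so that it stays finite and
  -- nonzero at $t=0$.
  ![((y.2 : ℝ) * √(y.2 : ℝ) * (2 + (y.2 : ℝ)) : ℝ), 0, (3 * √(y.2 : ℝ) : ℝ) * z,
    (√2 * (1 - (y.2 : ℝ)) : ℝ) * (y.1 : ℂ)]

theorem zeroHandleVec_ne_zero (z : ℂ) (y : Circle × unitInterval) : zeroHandleVec z y ≠ 0 := by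
  intro h
  have h0 := congrFun h 0
  have h1 := y.2.2.1
  simp only [zeroHandleVec, Matrix.cons_val_zero, Pi.zero_apply, Complex.ofReal_eq_zero] at h0
  linarith

theorem inftyHandleVec_ne_zero (z : ℂ) (y : Circle × unitInterval) : inftyHandleVec z y ≠ 0 := by
  intro h
  have h0 : (((y.2 : ℝ) * √(y.2 : ℝ) * (2 + (y.2 : ℝ)) : ℝ) : ℂ) = 0 := congrFun h 0
  have h3 : ((√2 * (1 - (y.2 : ℝ)) : ℝ) : ℂ) * (y.1 : ℂ) = 0 := congrFun h 3
  have h1 := y.2.2.1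
  rw [Complex.ofReal_eq_zero] at h0
  rw [mul_eq_zero, or_iff_left (Circle.coe_ne_zero _), Complex.ofReal_eq_zero, mul_eq_zero,
    or_iff_right (by positivity)] at h3
  have h4 : (y.2 : ℝ) = 1 := by linarith
  rw [h4] at h0
  norm_num at h0

open Classical in
/-- The handle with the given index, as a map from the cylinder to the quaternionic projective
line. -/
noncomputable def handleMap (h : HandleIndex) (y : Circle × unitInterval) : HP1 :=
  if (h.1 : OnePoint ℂ) = ((0 : ℂ) : OnePoint ℂ) then
    twistorProj (Projectivization.mk ℂ _ (zeroHandleVec_ne_zero h.2.1 y))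
  else twistorProj (Projectivization.mk ℂ _ (inftyHandleVec_ne_zero h.2.1 y))

theorem continuous_handleMap (h : HandleIndex) : Continuous (handleMap h) := by
  unfold handleMap
  split_ifs
  · refine continuous_twistorProj_mk (f := zeroHandleVec h.2.1) ?_ _
    unfold zeroHandleVec
    fun_prop
  · refine continuous_twistorProj_mk (f := inftyHandleVec h.2.1) ?_ _
    unfold inftyHandleVec
    fun_prop

theorem HandleIndex.pole_eq (h : HandleIndex) :
    (h.1 : OnePoint ℂ) = ((0 : ℂ) : OnePoint ℂ) ∨ (h.1 : OnePoint ℂ) = OnePoint.infty := h.1.2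

theorem handleMap_zero (h : HandleIndex) (c : Circle) :
    handleMap h (c, 0) = sphereToHP1 h.1.1 := by
  unfold handleMap
  rcases h.pole_eq with hP | hP
  · rw [if_pos hP, hP, sphereToHP1_coe, twistorProj_mk_eq_affinePoint_iff]
    simp [zeroHandleVec]
  · rw [if_neg (by rw [hP]; exact OnePoint.infty_ne_coe _), hP, sphereToHP1_infty,
      twistorProj_mk_eq_inftyPoint_iff]
    simp [inftyHandleVec]

theorem handleMap_one (h : HandleIndex) (c : Circle) :
    handleMap h (c, 1) = sphereToHP1 ((h.2.1 : ℂ) : OnePoint ℂ) := by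
  unfold handleMap
  split_ifs
  · rw [sphereToHP1_coe, twistorProj_mk_eq_affinePoint_iff]
    simp [zeroHandleVec]
    norm_num
  · rw [sphereToHP1_coe, twistorProj_mk_eq_affinePoint_iff]
    simp [inftyHandleVec]
    norm_num

open Classical in
/-- The radius of the double root parametrized by a point of a handle. -/
noncomputable def HandleIndex.radius (h : HandleIndex) (t : ℝ) : ℝ :=
  if (h.1 : OnePoint ℂ) = ((0 : ℂ) : OnePoint ℂ) then t else t⁻¹

theorem HandleIndex.radius_pos (h : HandleIndex) {t : ℝ} (ht : 0 < t) : 0 < h.radius t := by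
  unfold HandleIndex.radius
  split_ifs <;> positivity

theorem HandleIndex.radius_ne_one (h : HandleIndex) {t : ℝ} (ht : t ≠ 1) : h.radius t ≠ 1 := by
  unfold HandleIndex.radius
  split_ifs <;> simpa

theorem HandleIndex.eq_of_radius_eq {h h' : HandleIndex} {t t' : ℝ} (ht : 0 < t) (ht1 : t < 1)
    (ht' : 0 < t') (ht1' : t' < 1) (e : h.radius t = h'.radius t') : h.1 = h'.1 ∧ t = t' := by
  unfold HandleIndex.radius at e
  have i := (one_lt_inv₀ ht).2 ht1
  have i' := (one_lt_inv₀ ht').2 ht1'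
  have hne : (OnePoint.infty : OnePoint ℂ) ≠ ((0 : ℂ) : OnePoint ℂ) := OnePoint.infty_ne_coe _
  rcases h.pole_eq with hP | hP <;> rcases h'.pole_eq with hP' | hP'
  · rw [if_pos hP, if_pos hP'] at e
    exact ⟨Subtype.ext (hP.trans hP'.symm), e⟩
  · rw [if_pos hP, if_neg (by rwa [hP'])] at e
    linarith
  · rw [if_neg (by rwa [hP]), if_pos hP'] at e
    linarith
  · rw [if_neg (by rwa [hP]), if_neg (by rwa [hP'])] at e
    exact ⟨Subtype.ext (hP.trans hP'.symm), inv_injective e⟩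

theorem HandleIndex.exists_radius_eq {ρ : ℝ} (hρ : 0 < ρ) (hρ1 : ρ ≠ 1)
    (z : {z : ℂ // z ^ 3 = -1}) :
    ∃ h : HandleIndex, h.2 = z ∧ ∃ t : ℝ, 0 < t ∧ t < 1 ∧ h.radius t = ρ := by
  rcases lt_or_gt_of_ne hρ1 with h1 | h1
  · exact ⟨(⟨_, Or.inl rfl⟩, z), rfl, ρ, hρ, h1, if_pos rfl⟩
  · refine ⟨(⟨OnePoint.infty, Or.inr rfl⟩, z), rfl, ρ⁻¹, inv_pos.2 hρ, inv_lt_one_of_one_lt₀ h1, ?_⟩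
    exact (if_neg (OnePoint.infty_ne_coe _)).trans (inv_inv ρ)

/-- The modulus of the `ℂ`-coordinate of the point of a handle with radius `ρ`. -/
noncomputable def baseModulus (ρ : ℝ) : ℝ := 3 * ρ ^ 2 / (2 * ρ + 1)

/-- The modulus of the `ℂ j`-coordinate of the point of a handle with radius `ρ`. -/
noncomputable def normalModulus (ρ : ℝ) : ℝ := √2 * (ρ * √ρ) * |1 - ρ| / (2 * ρ + 1)

theorem baseModulus_pos {ρ : ℝ} (hρ : 0 < ρ) : 0 < baseModulus ρ := by
  unfold baseModulus
  positivity

theorem normalModulus_pos {ρ : ℝ} (hρ : 0 < ρ) (hρ1 : ρ ≠ 1) : 0 < normalModulus ρ := by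
  have : 0 < |1 - ρ| := abs_pos.2 (sub_ne_zero.2 hρ1.symm)
  unfold normalModulus
  positivity

theorem normalModulus_sq {ρ : ℝ} (hρ : 0 < ρ) :
    normalModulus ρ ^ 2 = 2 * ρ ^ 3 * (ρ - 1) ^ 2 / (2 * ρ + 1) ^ 2 := by
  unfold normalModulus
  rw [div_pow, mul_pow, mul_pow, mul_pow, sq_abs, Real.sq_sqrt hρ.le, Real.sq_sqrt zero_le_two]
  congr 1
  ring

/-- This recovers $\rho$ from $|z|$, which separates the handles at $0$ from those at $\infty$. -/
theorem baseModulus_injOn : Set.InjOn baseModulus (Set.Ioi 0) := by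
  intro ρ hρ σ hσ h
  rw [Set.mem_Ioi] at hρ hσ
  unfold baseModulus at h
  rw [div_eq_div_iff (by positivity) (by positivity)] at h
  have h1 : (ρ - σ) * (2 * ρ * σ + ρ + σ) = 0 := by linear_combination h / 3
  have h2 := (mul_eq_zero.1 h1).resolve_right (by positivity)
  linarith

theorem handleMap_eq_affinePoint (h : HandleIndex) (c : Circle) (t : unitInterval)
    (ht : 0 < (t : ℝ)) :
    handleMap h (c, t) = affinePoint (h.2.1 * baseModulus (h.radius t))
      (c * normalModulus (h.radius t)) := by
  have h1 := t.2.2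
  have hs : √(t : ℝ) ≠ 0 := (Real.sqrt_pos.2 ht).ne'
  have hss : √(t : ℝ) * √(t : ℝ) = t := Real.mul_self_sqrt ht.le
  unfold handleMap HandleIndex.radius
  split_ifs
  · rw [twistorProj_mk_eq_affinePoint_iff]
    have e1 : (3 * (t : ℝ) ^ 2 : ℝ) = (2 * (t : ℝ) + 1) * baseModulus t := by
      unfold baseModulus
      field_simp
    have e2 : √2 * ((t : ℝ) * √(t : ℝ)) * (1 - (t : ℝ)) = (2 * (t : ℝ) + 1) * normalModulus t := by
      unfold normalModulus
      rw [abs_of_nonneg (by linarith)]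
      field_simp
    simp only [zeroHandleVec, e1, e2]
    constructor
    · simp
      ring
    · simp
      ring
  · rw [twistorProj_mk_eq_affinePoint_iff]
    have e1 : 3 * √(t : ℝ) = (t : ℝ) * √(t : ℝ) * (2 + (t : ℝ)) * baseModulus (t : ℝ)⁻¹ := by
      unfold baseModulus
      field_simp
    have e2 : √2 * (1 - (t : ℝ)) =
        (t : ℝ) * √(t : ℝ) * (2 + (t : ℝ)) * normalModulus (t : ℝ)⁻¹ := by
      unfold normalModulus
      rw [abs_of_nonpos (by linarith [(one_le_inv₀ ht).2 h1]), Real.sqrt_inv]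
      field_simp
      ring
    simp only [inftyHandleVec, e1, e2]
    constructor
    · simp
      ring
    · simp
      ring

/-! ### The embedding of the pinched sphere -/

/-- The map from the sphere with six pinched handles to the quaternionic projective line. -/
noncomputable def pinchedSphereMap : PinchedSphere → HP1 :=
  Quot.lift (Sum.elim sphereToHP1 fun x => handleMap x.1 x.2) (by
    rintro _ _ (⟨h, c⟩ | ⟨h, c⟩)
    · exact handleMap_zero h c
    · exact handleMap_one h c)

theorem pinchedSphereMap_sphere (p : OnePoint ℂ) :
    pinchedSphereMap (Quot.mk PinchRel (Sum.inl p)) = sphereToHP1 p := rfl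

theorem continuous_pinchedSphereMap : Continuous pinchedSphereMap :=
  continuous_quot_lift _ (continuous_sphereToHP1.sumElim
    (continuous_sigma fun h => continuous_handleMap h))

theorem PinchedSphere.cases (x : PinchedSphere) :
    (∃ w, x = Quot.mk PinchRel (Sum.inl w)) ∨
      ∃ (h : HandleIndex) (c : Circle) (t : unitInterval), 0 < (t : ℝ) ∧ (t : ℝ) < 1 ∧
        x = Quot.mk PinchRel (Sum.inr ⟨h, (c, t)⟩) := by
  induction x using Quot.ind with
  | mk y =>
    rcases y with w | ⟨h, c, t⟩
    · exact Or.inl ⟨w, rfl⟩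
    · rcases t.2.1.eq_or_lt with h0 | h0
      · obtain rfl : t = 0 := Subtype.ext h0.symm
        exact Or.inl ⟨_, Quot.sound (PinchRel.pole h c)⟩
      · rcases t.2.2.eq_or_lt with h1 | h1
        · obtain rfl : t = 1 := Subtype.ext h1
          exact Or.inl ⟨_, Quot.sound (PinchRel.root h c)⟩
        · exact Or.inr ⟨h, c, t, h0, h1, rfl⟩

theorem pinchedSphereMap_handle (h : HandleIndex) (c : Circle) (t : unitInterval)
    (ht : 0 < (t : ℝ)) :
    pinchedSphereMap (Quot.mk PinchRel (Sum.inr ⟨h, (c, t)⟩)) =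
      affinePoint (h.2.1 * baseModulus (h.radius t)) (c * normalModulus (h.radius t)) :=
  handleMap_eq_affinePoint h c t ht

theorem handle_normal_ne_zero (h : HandleIndex) (c : Circle) {t : ℝ} (h0 : 0 < t) (h1 : t < 1) :
    (c : ℂ) * normalModulus (h.radius t) ≠ 0 :=
  mul_ne_zero (Circle.coe_ne_zero c) (Complex.ofReal_ne_zero.2
    (normalModulus_pos (h.radius_pos h0) (h.radius_ne_one h1.ne)).ne')

theorem sphereToHP1_ne_affinePoint (p : OnePoint ℂ) (z : ℂ) {w : ℂ} (hw : w ≠ 0) :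
    sphereToHP1 p ≠ affinePoint z w := by
  induction p using OnePoint.rec with
  | infty => exact (affinePoint_ne_inftyPoint z w).symm
  | coe u =>
    rw [sphereToHP1_coe, Ne, affinePoint_inj]
    exact fun h => hw h.2.symm

theorem pinchedSphereMap_injective : Function.Injective pinchedSphereMap := by
  intro x y hxy
  rcases x.cases with ⟨p, rfl⟩ | ⟨h, c, t, h0, h1, rfl⟩ <;>
    rcases y.cases with ⟨q, rfl⟩ | ⟨h', c', t', h0', h1', rfl⟩
  · rw [sphereToHP1_injective hxy]
  · rw [pinchedSphereMap_handle _ _ _ h0'] at hxy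
    exact absurd hxy (sphereToHP1_ne_affinePoint _ _ (handle_normal_ne_zero h' c' h0' h1'))
  · rw [pinchedSphereMap_handle _ _ _ h0] at hxy
    exact absurd hxy.symm (sphereToHP1_ne_affinePoint _ _ (handle_normal_ne_zero h c h0 h1))
  · rw [pinchedSphereMap_handle _ _ _ h0, pinchedSphereMap_handle _ _ _ h0', affinePoint_inj] at hxy
    obtain ⟨e1, e2⟩ := hxy
    have norm_root (z : {z : ℂ // z ^ 3 = -1}) : ‖z.1‖ = 1 := by
      have : ‖z.1‖ ^ 3 = 1 := by simpa using congrArg norm z.2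
      exact (pow_eq_one_iff_of_nonneg (norm_nonneg _) (by norm_num)).1 this
    have hρ := h.radius_pos h0
    have hρ' := h'.radius_pos h0'
    have e3 : baseModulus (h.radius t) = baseModulus (h'.radius t') := by
      have := congrArg norm e1
      rwa [norm_mul, norm_mul, norm_root, norm_root, one_mul, one_mul, Complex.norm_real,
        Complex.norm_real, Real.norm_of_nonneg (baseModulus_pos hρ).le,
        Real.norm_of_nonneg (baseModulus_pos hρ').le] at this
    have e4 := baseModulus_injOn hρ hρ' e3
    obtain ⟨e5, e6⟩ := HandleIndex.eq_of_radius_eq h0 h1 h0' h1' e4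
    -- With $\rho$ known, the phase of $z$ gives the cube root of $-1$ and the phase of $w$ the
    -- point of the circle.
    rw [← e4] at e1 e2
    have e7 : h.2 = h'.2 := Subtype.ext (mul_right_cancel₀
      (Complex.ofReal_ne_zero.2 (baseModulus_pos hρ).ne') e1)
    have e8 : c = c' := Circle.ext (mul_right_cancel₀ (Complex.ofReal_ne_zero.2
      (normalModulus_pos hρ (h.radius_ne_one h1.ne)).ne') e2)
    rw [Prod.ext e5 e7, e8, Subtype.ext e6]

theorem compactSpace_pinchedSphere : CompactSpace PinchedSphere := by
  have : Finite {z : ℂ // z ^ 3 = -1} := by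
    have h : {z : ℂ | z ^ 3 = -1} ⊆ ((Polynomial.nthRoots 3 (-1 : ℂ)).toFinset : Set ℂ) := by
      intro z hz
      simpa [Polynomial.mem_nthRoots] using hz
    exact ((Finset.finite_toSet _).subset h).to_subtype
  have : Finite ({((0 : ℂ) : OnePoint ℂ), OnePoint.infty} : Set (OnePoint ℂ)) :=
    (Set.toFinite _).to_subtype
  infer_instance

theorem isEmbedding_pinchedSphereMap : Topology.IsEmbedding pinchedSphereMap :=
  have := HP1.t2Space
  have := compactSpace_pinchedSphere
  (continuous_pinchedSphereMap.isClosedEmbedding pinchedSphereMap_injective).isEmbedding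

theorem image_attachingPoints :
    pinchedSphereMap '' attachingPoints = twistorLines cubicScroll 3 := by
  have hroot : (-1 : ℂ) ^ 3 = -1 := by norm_num
  ext q
  constructor
  · rintro ⟨_, ⟨h, rfl | rfl⟩, rfl⟩
    · rw [pinchedSphereMap_sphere]
      rcases h.pole_eq with hP | hP
      · rw [hP, sphereToHP1_coe, affinePoint_mem_twistorLines_iff]
        simp
      · rw [hP]
        exact inftyPoint_mem_twistorLines
    · rw [pinchedSphereMap_sphere, sphereToHP1_coe, affinePoint_mem_twistorLines_iff]
      exact ⟨rfl, star_sq_add_eq_zero_iff.2 (Or.inr h.2.2)⟩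
  · intro hq
    rcases eq_inftyPoint_or_affinePoint q with rfl | ⟨z, w, rfl⟩
    · exact ⟨_, ⟨(⟨OnePoint.infty, Or.inr rfl⟩, ⟨-1, hroot⟩), Or.inl rfl⟩,
        pinchedSphereMap_sphere _⟩
    · obtain ⟨rfl, hz⟩ := affinePoint_mem_twistorLines_iff.1 hq
      rcases star_sq_add_eq_zero_iff.1 hz with rfl | hz
      · exact ⟨_, ⟨(⟨_, Or.inl rfl⟩, ⟨-1, hroot⟩), Or.inl rfl⟩,
          (pinchedSphereMap_sphere _).trans (sphereToHP1_coe 0)⟩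
      · exact ⟨_, ⟨(⟨_, Or.inl rfl⟩, ⟨z, hz⟩), Or.inr rfl⟩,
          (pinchedSphereMap_sphere _).trans (sphereToHP1_coe z)⟩

theorem affinePoint_mem_range_iff {z w : ℂ} (hw : w ≠ 0) :
    affinePoint z w ∈ Set.range pinchedSphereMap ↔ affinePoint z w ∈ doublePoints cubicScroll := by
  rw [affinePoint_mem_doublePoints_iff hw]
  constructor
  · rintro ⟨x, hx⟩
    rcases x.cases with ⟨p, rfl⟩ | ⟨h, c, t, h0, h1, rfl⟩
    · exact absurd hx (sphereToHP1_ne_affinePoint p z hw)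
    · rw [pinchedSphereMap_handle _ _ _ h0, affinePoint_inj] at hx
      obtain ⟨rfl, rfl⟩ := hx
      refine ⟨_, h.radius_pos h0, h.2.1, h.2.2, rfl, ?_⟩
      rw [← normalModulus_sq (h.radius_pos h0), norm_mul, Circle.norm_coe, one_mul,
        Complex.norm_real, Real.norm_eq_abs, sq_abs]
  · rintro ⟨ρ, hρ, x, hx, rfl, hr⟩
    have hw' : 0 < ‖w‖ := norm_pos_iff.2 hw
    -- At $\rho=1$ the circle has shrunk to the point $x$ of the sphere, where $w=0$.
    have hρ1 : ρ ≠ 1 := by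
      rintro rfl
      norm_num at hr
      exact hw hr
    rw [← normalModulus_sq hρ] at hr
    have hn := normalModulus_pos hρ hρ1
    have hr' : ‖w‖ = normalModulus ρ :=
      (pow_left_inj₀ hw'.le hn.le two_ne_zero).1 hr
    obtain ⟨h, hz, t, h0, h1, rfl⟩ := HandleIndex.exists_radius_eq hρ hρ1 ⟨x, hx⟩
    have hnc : ((normalModulus (h.radius t) : ℝ) : ℂ) ≠ 0 := Complex.ofReal_ne_zero.2 hn.ne'
    have hc : ‖w / (normalModulus (h.radius t) : ℂ)‖ = 1 := by
      rw [norm_div, hr', Complex.norm_real, Real.norm_of_nonneg hn.le, div_self hn.ne']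
    obtain ⟨c, hcw⟩ : ∃ c : Circle, (c : ℂ) * normalModulus (h.radius t) = w :=
      ⟨⟨_, mem_sphere_zero_iff_norm.2 hc⟩, div_mul_cancel₀ _ hnc⟩
    refine ⟨Quot.mk _ (Sum.inr ⟨h, (c, ⟨t, h0.le, h1.le⟩)⟩), ?_⟩
    rw [pinchedSphereMap_handle _ _ ⟨t, h0.le, h1.le⟩ h0, affinePoint_inj, hz]
    exact ⟨rfl, hcw⟩

theorem doublePoints_eq :
    doublePoints cubicScroll = Set.range pinchedSphereMap \ twistorLines cubicScroll 3 := by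
  ext q
  rcases eq_inftyPoint_or_affinePoint q with rfl | ⟨z, w, rfl⟩
  · exact iff_of_false inftyPoint_notMem_doublePoints fun h => h.2 inftyPoint_mem_twistorLines
  · rw [Set.mem_sdiff, affinePoint_mem_twistorLines_iff]
    by_cases hw : w = 0
    · subst hw
      rw [affinePoint_zero_mem_doublePoints_iff]
      have : affinePoint z 0 ∈ Set.range pinchedSphereMap :=
        ⟨Quot.mk _ (Sum.inl (z : OnePoint ℂ)), sphereToHP1_coe z⟩
      simp only [this, true_and]
    · rw [affinePoint_mem_range_iff hw]
      simp [hw]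

theorem proposition5p5 :
    Nonempty (↥(doublePoints cubicScroll) ≃ₜ ↥(attachingPointsᶜ : Set PinchedSphere)) ∧
    ∃ Φ : PinchedSphere → HP1,
      Topology.IsEmbedding Φ ∧
      (∀ w : OnePoint ℂ, Φ (Quot.mk PinchRel (Sum.inl w)) = sphereToHP1 w) ∧
      Φ '' attachingPoints = twistorLines cubicScroll 3 ∧
      doublePoints cubicScroll = Set.range Φ \ twistorLines cubicScroll 3 := by
  have h : pinchedSphereMap '' attachingPointsᶜ = doublePoints cubicScroll := by
    rw [doublePoints_eq, ← image_attachingPoints, ← Set.image_univ,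
      ← Set.image_sdiff pinchedSphereMap_injective, Set.compl_eq_univ_sdiff]
  exact ⟨⟨((isEmbedding_pinchedSphereMap.homeomorphImage _).trans (Homeomorph.setCongr h)).symm⟩,
    pinchedSphereMap, isEmbedding_pinchedSphereMap, pinchedSphereMap_sphere, image_attachingPoints,
    doublePoints_eq⟩
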